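/- Fix a real number $d>1$. In the $d$-choice process on $n\ge 1$ initially empty bins, balls are placed one after the other; when a ball is placed, the bins are ranked by non-increasing current load (ties broken by a fixed ordering of the bins), and for each $i\in\{1,\dots,n\}$ the ball goes to one of the $i$ heaviest bins with probability exactly $(i/n)^d$, i.e. to the bin of rank $i$ with probability $(i/n)^d-((i-1)/n)^d$, independently of the past given the current loads. (For integer $d$ this is the process in which each ball samples $d$ bins uniformly and independently and goes to the least loaded of them.) For an integer $t\ge 0$ let $X^t_i$ be the load of bin $i$ after $tn$ balls minus the average load $t$, and let $G^t=\max_i X^t_i$ be the gap. Write $\log$ for the natural logarithm and $\log_d$ for the logarithm to base $d$. Call a pair $(a,b)$ of real numbers with $a>0$ *admissible* if for all sufficiently large $n$ and all $t\ge 0$, $\mathbb E\big[\sum_{i=1}^n \exp(a|X^t_i|)\big]\le bn$. Then admissible pairs exist, and for every admissible pair $(a,b)$ there are constants $\gamma,\alpha\in\mathbb R$ (depending only on $d,a,b$) such that the following holds. For every function $\tau:\mathbb N\to\mathbb R$ with $\tau(n)/\log n\to\infty$ there is an $N$ such that for all $n\ge N$, all integers $t\ge\tau(n)$ and all real $k\ge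 0$, $$\Pr\big[G^t\ge \log_d\log n+\alpha\log\log\log n+k+\gamma\big]\le \frac1{n^{10}}+\frac1{\log^4 n}+\frac{\exp(-ak)}{(\log\log n)^4}.$$ -/

import Mathlib

open Filter Topology MeasureTheory

noncomputable section

namespace Greedy

/-- The probability that a ball of the `d`-choice process goes to the bin of rank `r` (rank `0` is
the heaviest bin) among `n` bins: the `i` heaviest bins together get it with probability
`(i / n) ^ d`. -/
def rankProb (d : ℝ) (n : ℕ) (r : ℕ) : ℝ :=
  (((r + 1 : ℕ) : ℝ) / n) ^ d - ((r : ℝ) / n) ^ d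

theorem rankProb_nonneg {d : ℝ} (hd : 1 < d) (n r : ℕ) : 0 ≤ rankProb d n r := by
  unfold rankProb
  rw [sub_nonneg]
  apply Real.rpow_le_rpow (by positivity) _ (by linarith)
  gcongr
  omega

theorem sum_rankProb {d : ℝ} (hd : 1 < d) (n : ℕ) [NeZero n] :
    ∑ r : Fin n, ENNReal.ofReal (rankProb d n r) = 1 := by
  rw [← ENNReal.ofReal_sum_of_nonneg (f := fun r : Fin n => rankProb d n r)
      (fun r _ => rankProb_nonneg hd n r),
    Fin.sum_univ_eq_sum_range (fun r => rankProb d n r) n]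
  unfold rankProb
  rw [Finset.sum_range_sub (fun r : ℕ => ((r : ℝ) / n) ^ d)]
  have h0 : d ≠ 0 := by linarith
  have hn : (n : ℝ) ≠ 0 := Nat.cast_ne_zero.mpr (NeZero.ne n)
  simp [h0, hn]

/-- The law of the rank of the bin that receives a ball. -/
def rankPMF {d : ℝ} (hd : 1 < d) (n : ℕ) [NeZero n] : PMF (Fin n) :=
  PMF.ofFintype (fun r => ENNReal.ofReal (rankProb d n r)) (sum_rankProb hd n)

/-- The bin of rank `r` in the allocation `x`: the bins are listed by non-increasing load, and
ties are broken by the fixed ordering of the bins. -/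
def binOfRank {n : ℕ} (x : Fin n → ℕ) (r : Fin n) : Fin n :=
  Tuple.sort (fun i => OrderDual.toDual (x i)) r

/-- The listing is by non-increasing load. -/
theorem antitone_binOfRank {n : ℕ} (x : Fin n → ℕ) : Antitone (fun r => x (binOfRank x r)) :=
  fun _ _ h => Tuple.monotone_sort (fun i => OrderDual.toDual (x i)) h

/-- The allocation obtained from `x` by placing one more ball in bin `j`. -/
def addBall {n : ℕ} (x : Fin n → ℕ) (j : Fin n) : Fin n → ℕ :=
  Function.update x j (x j + 1)

/-- The law of the numbers of balls in the `n` bins after `m` balls were placed, one after the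
other, by the `d`-choice process into initially empty bins. -/
def allocation {d : ℝ} (hd : 1 < d) (n : ℕ) [NeZero n] : ℕ → PMF (Fin n → ℕ)
  | 0 => PMF.pure (fun _ => 0)
  | m + 1 => (allocation hd n m).bind fun x =>
      (rankPMF hd n).map fun r => addBall x (binOfRank x r)

/-- The law of the allocation after `t * n` balls, as a measure. -/
def allocationAt {d : ℝ} (hd : 1 < d) (n : ℕ) [NeZero n] (t : ℕ) : Measure (Fin n → ℕ) :=
  (allocation hd n (t * n)).toMeasure

/-- The normalized load of bin `i`: its load minus the average load. -/
def normLoad {n : ℕ} (x : Fin n → ℕ) (i : Fin n) : ℝ :=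
  (x i : ℝ) - (∑ j, (x j : ℝ)) / n

/-- The gap: maximum load minus average load. -/
def gap {n : ℕ} (x : Fin n → ℕ) : ℝ := ⨆ i, normLoad x i

/-- `a` and `b` are constants for the exponential potential of the `d`-choice process: for all
sufficiently large `n` and all `t`, the expectation of `∑ i, exp (a * |X_i|)` after `t * n` balls
is at most `b * n`. -/
def PotentialBound {d : ℝ} (hd : 1 < d) (a b : ℝ) : Prop :=
  0 < a ∧ ∃ N : ℕ, ∀ (n : ℕ) [NeZero n], N ≤ n → ∀ t : ℕ,
    ∫⁻ x, ENNReal.ofReal (∑ i, Real.exp (a * |normLoad x i|)) ∂(allocationAt hd n t)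
      ≤ ENNReal.ofReal (b * n)

end Greedy

end

noncomputable section

namespace Greedy

/-! At any fixed time the exponential potential controls two things through Markov's inequality: the
gap is O(log n) except with probability of order n^(-11), and the number of bins at least g above
the average is typically of order n e^(-ag).

Layered induction turns a crude gap bound L into a sharp one. Suppose the gap is below L after tn
balls, and place Ln more. All loads were below t + L, the final average, so every ball above a
height h ≥ t + L is new. If at most a fraction e^(-1) (6L)^(-1/(d-1)) of the bins ends at height h
or more, this also held all along, since such counts never decrease; a ball then lands on one of
these bins with probability at most the d-th power of that fraction. With high probability the
fractions of bins reaching h + i are thus dominated by solutions of β' = 6Lβ^d. These decay like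
exp(-d^i) and reach order log n / n after about log_d log n levels; boundedly many further levels
finish. Choosing h = t + L + g costs a probability of order L^(1/(d-1)) e^(-ag).

This reduction (`eventually_gap_reduction`) is used twice: L of order log n and g of order log log n
give a gap O(log log n); then L of order log log n and g = α log log log n + k give the claim.
Admissible pairs exist by a drift bound for the two-sided potential (`stepExp_potential_le`). -/

/-! ### The transition operator and its elementary probability rules. -/

/-- The expectation of `f` after one more ball, as a function of the current allocation. -/
def stepExp (d : ℝ) {n : ℕ} (f : (Fin n → ℕ) → ℝ) (x : Fin n → ℕ) : ℝ :=
  ∑ r : Fin n, rankProb d n r * f (addBall x (binOfRank x r))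

theorem sum_rankProb_real {d : ℝ} (hd : 1 < d) (n : ℕ) [NeZero n] :
    ∑ r : Fin n, rankProb d n r = 1 := by
  have h := sum_rankProb hd n
  rw [← ENNReal.ofReal_sum_of_nonneg (f := fun r : Fin n => rankProb d n r)
    (fun r _ => rankProb_nonneg hd n r)] at h
  simpa using h

theorem stepExp_mono {d : ℝ} (hd : 1 < d) {n : ℕ} {f g : (Fin n → ℕ) → ℝ} {x : Fin n → ℕ}
    (h : ∀ j, f (addBall x j) ≤ g (addBall x j)) : stepExp d f x ≤ stepExp d g x :=
  Finset.sum_le_sum fun r _ => mul_le_mul_of_nonneg_left (h _) (rankProb_nonneg hd n r)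

theorem stepExp_nonneg {d : ℝ} (hd : 1 < d) {n : ℕ} {f : (Fin n → ℕ) → ℝ}
    (h : ∀ x, 0 ≤ f x) (x : Fin n → ℕ) : 0 ≤ stepExp d f x :=
  Finset.sum_nonneg fun r _ => mul_nonneg (rankProb_nonneg hd n r) (h _)

theorem stepExp_add (d : ℝ) {n : ℕ} (f g : (Fin n → ℕ) → ℝ) :
    stepExp d (fun x => f x + g x) = fun x => stepExp d f x + stepExp d g x := by
  funext x
  simp [stepExp, mul_add, Finset.sum_add_distrib]

theorem stepExp_const_mul (d : ℝ) {n : ℕ} (c : ℝ) (f : (Fin n → ℕ) → ℝ) :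
    stepExp d (fun x => c * f x) = fun x => c * stepExp d f x := by
  funext x
  simp only [stepExp, Finset.mul_sum]
  exact Finset.sum_congr rfl fun _ _ => by ring

theorem stepExp_const {d : ℝ} (hd : 1 < d) {n : ℕ} [NeZero n] (c : ℝ) :
    stepExp d (fun _ : Fin n → ℕ => c) = fun _ => c := by
  funext x
  simp [stepExp, ← Finset.sum_mul, sum_rankProb_real hd n]

theorem sum_addBall {n : ℕ} (x : Fin n → ℕ) (j : Fin n) :
    ∑ i, addBall x j i = ∑ i, x i + 1 := by
  have h : ∀ i, addBall x j i = x i + if i = j then 1 else 0 := by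
    intro i
    by_cases hij : i = j
    · subst hij; simp [addBall]
    · simp [addBall, hij]
  simp [h, Finset.sum_add_distrib]

/-- Each ball raises the total by one, so only allocations with the right total matter; this lets
later events use the exact average load. -/
theorem iterate_stepExp_mono_of_sum {d : ℝ} (hd : 1 < d) {n : ℕ} {f g : (Fin n → ℕ) → ℝ}
    (m : ℕ) {x : Fin n → ℕ} (h : ∀ y, ∑ i, y i = ∑ i, x i + m → f y ≤ g y) :
    (stepExp d)^[m] f x ≤ (stepExp d)^[m] g x := by
  induction m generalizing x with
  | zero => exact h x (by simp)
  | succ m ih =>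
    rw [Function.iterate_succ_apply', Function.iterate_succ_apply']
    refine stepExp_mono hd fun j => ih fun y hy => h y ?_
    rw [hy, sum_addBall]; ring

theorem iterate_stepExp_mono {d : ℝ} (hd : 1 < d) {n : ℕ} {f g : (Fin n → ℕ) → ℝ}
    (m : ℕ) (x : Fin n → ℕ) (h : ∀ y, f y ≤ g y) :
    (stepExp d)^[m] f x ≤ (stepExp d)^[m] g x :=
  iterate_stepExp_mono_of_sum hd m fun y _ => h y

theorem iterate_stepExp_nonneg {d : ℝ} (hd : 1 < d) {n : ℕ} {f : (Fin n → ℕ) → ℝ}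
    (m : ℕ) (x : Fin n → ℕ) (h : ∀ y, 0 ≤ f y) : 0 ≤ (stepExp d)^[m] f x := by
  induction m generalizing x with
  | zero => exact h x
  | succ m ih =>
    rw [Function.iterate_succ_apply']
    exact stepExp_nonneg hd ih x

theorem iterate_stepExp_add (d : ℝ) {n : ℕ} (m : ℕ) (f g : (Fin n → ℕ) → ℝ) :
    (stepExp d)^[m] (fun x => f x + g x) =
      fun x => (stepExp d)^[m] f x + (stepExp d)^[m] g x := by
  induction m with
  | zero => rfl
  | succ m ih => simp only [Function.iterate_succ_apply', ih, stepExp_add]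

theorem iterate_stepExp_const_mul (d : ℝ) {n : ℕ} (m : ℕ) (c : ℝ) (f : (Fin n → ℕ) → ℝ) :
    (stepExp d)^[m] (fun x => c * f x) = fun x => c * (stepExp d)^[m] f x := by
  induction m with
  | zero => rfl
  | succ m ih => simp only [Function.iterate_succ_apply', ih, stepExp_const_mul]

theorem iterate_stepExp_const {d : ℝ} (hd : 1 < d) {n : ℕ} [NeZero n] (m : ℕ) (c : ℝ) :
    (stepExp d)^[m] (fun _ : Fin n → ℕ => c) = fun _ => c := by
  induction m with
  | zero => rfl
  | succ m ih => simp only [Function.iterate_succ_apply', ih, stepExp_const hd]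

theorem tsum_bind_mul {α β : Type*} (p : PMF α) (g : α → PMF β) (f : β → ENNReal) :
    ∑' b, p.bind g b * f b = ∑' a, p a * ∑' b, g a b * f b := by
  simp only [PMF.bind_apply, ← ENNReal.tsum_mul_right, ← ENNReal.tsum_mul_left]
  rw [ENNReal.tsum_comm]
  simp only [mul_assoc]

theorem tsum_pure_mul {β : Type*} (b : β) (f : β → ENNReal) :
    ∑' c, PMF.pure b c * f c = f b := by
  rw [tsum_eq_single b]
  · simp
  · intro c hc; simp [hc]

/-- The backward equation: iterates of the operator acting on functions replace the laws in all
later arguments. -/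
theorem tsum_allocation {d : ℝ} (hd : 1 < d) (n : ℕ) [NeZero n] (m : ℕ)
    (f : (Fin n → ℕ) → ℝ) (hf : ∀ x, 0 ≤ f x) :
    ∑' x, allocation hd n m x * ENNReal.ofReal (f x)
      = ENNReal.ofReal ((stepExp d)^[m] f (fun _ => 0)) := by
  induction m generalizing f with
  | zero => simp only [allocation, tsum_pure_mul]; rfl
  | succ m ih =>
    rw [Function.iterate_succ_apply, ← ih _ (stepExp_nonneg hd hf), allocation, tsum_bind_mul]
    refine tsum_congr fun x => ?_
    congr 1
    rw [PMF.map, tsum_bind_mul, tsum_fintype, stepExp, ENNReal.ofReal_sum_of_nonneg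
      (f := fun r : Fin n => rankProb d n r * f (addBall x (binOfRank x r)))
      fun r _ => mul_nonneg (rankProb_nonneg hd n r) (hf _)]
    refine Finset.sum_congr rfl fun r _ => ?_
    rw [ENNReal.ofReal_mul (rankProb_nonneg hd n r)]
    simp only [Function.comp, tsum_pure_mul]
    rfl

theorem lintegral_allocationAt {d : ℝ} (hd : 1 < d) (n : ℕ) [NeZero n] (t : ℕ)
    (f : (Fin n → ℕ) → ℝ) (hf : ∀ x, 0 ≤ f x) :
    ∫⁻ x, ENNReal.ofReal (f x) ∂(allocationAt hd n t)
      = ENNReal.ofReal ((stepExp d)^[t * n] f (fun _ => 0)) := by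
  rw [← tsum_allocation hd n (t * n) f hf, lintegral_countable', allocationAt]
  refine tsum_congr fun x => ?_
  rw [PMF.toMeasure_apply_singleton _ _ (measurableSet_singleton x), mul_comm]

/-- The probability that the allocation after `m` balls, started from `x`, lies in `S`. -/
def probFrom (d : ℝ) {n : ℕ} (m : ℕ) (x : Fin n → ℕ) (S : Set (Fin n → ℕ)) : ℝ :=
  (stepExp d)^[m] (S.indicator fun _ => 1) x

theorem real_allocationAt {d : ℝ} (hd : 1 < d) (n : ℕ) [NeZero n] (t : ℕ)
    (S : Set (Fin n → ℕ)) :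
    (allocationAt hd n t).real S = probFrom d (t * n) (fun _ => 0) S := by
  have h0 : ∀ x, 0 ≤ S.indicator (fun _ : Fin n → ℕ => (1 : ℝ)) x :=
    fun x => Set.indicator_nonneg (fun _ _ => zero_le_one) x
  have h := lintegral_allocationAt hd n t _ h0
  have h1 : ∀ x, ENNReal.ofReal (S.indicator (fun _ : Fin n → ℕ => (1 : ℝ)) x)
      = S.indicator 1 x := by
    intro x
    by_cases hx : x ∈ S <;> simp [hx]
  simp only [h1] at h
  rw [lintegral_indicator_one S.to_countable.measurableSet] at h
  rw [measureReal_def, h, ENNReal.toReal_ofReal (iterate_stepExp_nonneg hd _ _ h0), probFrom]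

theorem probFrom_mono_of_sum {d : ℝ} (hd : 1 < d) {n : ℕ} (m : ℕ) {x : Fin n → ℕ}
    {S U : Set (Fin n → ℕ)} (h : ∀ y, ∑ i, y i = ∑ i, x i + m → y ∈ S → y ∈ U) :
    probFrom d m x S ≤ probFrom d m x U := by
  refine iterate_stepExp_mono_of_sum hd m fun y hy => ?_
  by_cases hS : y ∈ S
  · simp [hS, h y hy hS]
  · simp only [hS, not_false_eq_true, Set.indicator_of_notMem]
    exact Set.indicator_nonneg (fun _ _ => zero_le_one) y

theorem probFrom_union_le {d : ℝ} (hd : 1 < d) {n : ℕ} (m : ℕ) (x : Fin n → ℕ)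
    (S U : Set (Fin n → ℕ)) :
    probFrom d m x (S ∪ U) ≤ probFrom d m x S + probFrom d m x U := by
  have h := congrFun (iterate_stepExp_add d m (S.indicator fun _ : Fin n → ℕ => (1 : ℝ))
    (U.indicator fun _ => 1)) x
  rw [probFrom, probFrom, probFrom, ← h]
  refine iterate_stepExp_mono hd m x fun y => ?_
  by_cases hS : y ∈ S <;> by_cases hU : y ∈ U <;> simp [hS, hU]

/-- Markov's inequality. -/
theorem probFrom_le_of_le {d : ℝ} (hd : 1 < d) {n : ℕ} (m : ℕ) {x : Fin n → ℕ}
    {S : Set (Fin n → ℕ)} {f : (Fin n → ℕ) → ℝ} {c B : ℝ} (hc : 0 < c) (hf : ∀ y, 0 ≤ f y)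
    (hS : ∀ y, ∑ i, y i = ∑ i, x i + m → y ∈ S → c ≤ f y)
    (hB : (stepExp d)^[m] f x ≤ B) : probFrom d m x S ≤ B / c := by
  rw [le_div_iff₀ hc, mul_comm]
  have h := congrFun (iterate_stepExp_const_mul d m c
    (S.indicator fun _ : Fin n → ℕ => (1 : ℝ))) x
  rw [probFrom, ← h]
  refine (iterate_stepExp_mono_of_sum hd m fun y hy => ?_).trans hB
  by_cases hyS : y ∈ S
  · simpa [hyS] using hS y hy hyS
  · simpa [hyS] using hf y

/-- The Markov property at time `m`, with a bad event `U` for the allocation at that time. -/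
theorem probFrom_add_le {d : ℝ} (hd : 1 < d) {n : ℕ} [NeZero n] (m k : ℕ) {x : Fin n → ℕ}
    {S U : Set (Fin n → ℕ)} {B : ℝ} (hB : 0 ≤ B)
    (h : ∀ y, ∑ i, y i = ∑ i, x i + m → y ∉ U → probFrom d k y S ≤ B) :
    probFrom d (m + k) x S ≤ probFrom d m x U + B := by
  have h1 : ∀ y, probFrom d k y S ≤ 1 := by
    intro y
    have hc := congrFun (iterate_stepExp_const (n := n) hd k 1) y
    refine (iterate_stepExp_mono hd k y fun z => ?_).trans_eq hc
    by_cases hz : z ∈ S <;> simp [hz]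
  have hc := congrFun (iterate_stepExp_const (n := n) hd m B) x
  have ha := congrFun (iterate_stepExp_add d m (U.indicator fun _ : Fin n → ℕ => (1 : ℝ))
    (fun _ => B)) x
  simp only [hc] at ha
  rw [probFrom, probFrom, Function.iterate_add_apply, ← ha]
  refine iterate_stepExp_mono_of_sum hd m fun y hy => ?_
  by_cases hyU : y ∈ U
  · simp only [hyU, Set.indicator_of_mem]
    exact (h1 y).trans (by linarith)
  · simpa [hyU, probFrom] using h y hy hyU

/-! ### Drift of the exponential potential and existence of admissible pairs. -/

theorem rankProb_le {d : ℝ} (hd : 1 < d) {n r : ℕ} (hr : r < n) : rankProb d n r ≤ d / n := by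
  have hn : (0 : ℝ) < n := by exact_mod_cast (by omega : 0 < n)
  have hu : (0 : ℝ) < ((r + 1 : ℕ) : ℝ) / n := by positivity
  have hu1 : ((r + 1 : ℕ) : ℝ) / n ≤ 1 := by
    rw [div_le_one hn]; exact_mod_cast hr
  -- Writing the smaller base as a multiple of the larger one prepares for Bernoulli's inequality.
  have hv : (r : ℝ) / n = ((r + 1 : ℕ) : ℝ) / n * (1 + -(1 / (r + 1 : ℝ))) := by
    have : (r : ℝ) + 1 ≠ 0 := by positivity
    push_cast; field_simp; ring
  have hs : -1 ≤ -(1 / (r + 1 : ℝ)) := by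
    rw [neg_le_neg_iff, div_le_one (by positivity)]
    linarith [(Nat.cast_nonneg r : (0 : ℝ) ≤ r)]
  have hB := one_add_mul_self_le_rpow_one_add hs hd.le
  have hw : (0 : ℝ) ≤ 1 + -(1 / (r + 1 : ℝ)) := by linarith
  have hud : (((r + 1 : ℕ) : ℝ) / n) ^ d ≤ ((r + 1 : ℕ) : ℝ) / n := by
    conv_rhs => rw [← Real.rpow_one (((r + 1 : ℕ) : ℝ) / n)]
    exact Real.rpow_le_rpow_of_exponent_ge hu hu1 hd.le
  have hu0 : 0 ≤ (((r + 1 : ℕ) : ℝ) / n) ^ d := by positivity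
  rw [rankProb, hv, Real.mul_rpow hu.le hw]
  calc _ ≤ (((r + 1 : ℕ) : ℝ) / n) ^ d * (d * (1 / (r + 1 : ℝ))) := by nlinarith
    _ ≤ ((r + 1 : ℕ) : ℝ) / n * (d * (1 / (r + 1 : ℝ))) := by gcongr
    _ = d / n := by
      have : (r : ℝ) + 1 ≠ 0 := by positivity
      push_cast; field_simp

/-- By concavity u - u^d lies above the tent through its values at 0, 1/2 and 1. -/
theorem sub_rpow_ge {d : ℝ} (hd : 1 < d) {u : ℝ} (h0 : 0 ≤ u) (h1 : u ≤ 1) :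
    (1 - (1 / 2 : ℝ) ^ (d - 1)) * min u (1 - u) ≤ u - u ^ d := by
  have hhalf : (1 / 2 : ℝ) ^ d = (1 / 2) ^ (d - 1) * (1 / 2) := by
    rw [← Real.rpow_add_one (by norm_num)]; ring_nf
  rcases le_total u (1 / 2) with h | h
  · rw [min_eq_left (by linarith)]
    rcases h0.eq_or_lt with rfl | hu
    · simp [Real.zero_rpow (by linarith : d ≠ 0)]
    have : u ^ d = u ^ (d - 1) * u := by
      rw [← Real.rpow_add_one hu.ne']; ring_nf
    have h2 : u ^ (d - 1) ≤ (1 / 2 : ℝ) ^ (d - 1) := Real.rpow_le_rpow h0 h (by linarith)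
    rw [this]
    nlinarith
  · rw [min_eq_right (by linarith)]
    have hc := (convexOn_rpow hd.le).2 (show (1 : ℝ) ∈ Set.Ici 0 by simp)
      (show (1 / 2 : ℝ) ∈ Set.Ici 0 by norm_num) (show 0 ≤ 2 * u - 1 by linarith)
      (show 0 ≤ 2 - 2 * u by linarith) (by ring)
    simp only [smul_eq_mul, Real.one_rpow, mul_one] at hc
    rw [show 2 * u - 1 + (2 - 2 * u) * (1 / 2) = u by ring, hhalf] at hc
    nlinarith

/-- `1` on the heavier half of the ranks, `-1` on the lighter half, `0` on a middle rank. -/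
def halfSign (n s : ℕ) : ℝ := (if s < n / 2 then 1 else 0) - (if n - n / 2 ≤ s then 1 else 0)

/-- The prefix sums form the tent of `sub_rpow_ge`, scaled by n; hence this sign pattern serves as
the comparison bias. -/
theorem sum_range_halfSign {n i : ℕ} (hi : i ≤ n) :
    ∑ s ∈ Finset.range i, halfSign n s = ((min i (n - i) : ℕ) : ℝ) := by
  induction i with
  | zero => simp
  | succ i ih =>
    rw [Finset.sum_range_succ, ih (by omega), halfSign]
    by_cases h1 : i < n / 2
    · have h2 : ¬ n - n / 2 ≤ i := by omega
      have h3 : min (i + 1) (n - (i + 1)) = min i (n - i) + 1 := by omega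
      rw [h3]; simp [h1, h2]
    · by_cases h2 : n - n / 2 ≤ i
      · have h3 : min i (n - i) = min (i + 1) (n - (i + 1)) + 1 := by omega
        rw [h3]; simp [h1, h2]
      · have h3 : min i (n - i) = min (i + 1) (n - (i + 1)) := by omega
        rw [h3]; simp [h1, h2]

/-- Abel summation. -/
theorem sum_mul_le_of_prefix_nonpos (e w : ℕ → ℝ) (hw : Antitone w) (n : ℕ)
    (he : ∀ i ≤ n, ∑ s ∈ Finset.range i, e s ≤ 0) :
    ∑ s ∈ Finset.range n, e s * w s ≤ (∑ s ∈ Finset.range n, e s) * w (n - 1) := by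
  induction n with
  | zero => simp
  | succ n ih =>
    rw [Finset.sum_range_succ, Finset.sum_range_succ, Nat.add_sub_cancel, add_mul]
    have h1 := ih fun i hi => he i (by omega)
    have h2 := mul_le_mul_of_nonpos_left (hw (Nat.sub_le n 1)) (he n (by omega))
    linarith

/-- The bias of the process is at least as favourable as moving mass ε/n from each heavy rank to
each light one: the difference `e` has nonpositive prefix sums and total zero. -/
theorem sum_rankProb_mul_le {d : ℝ} (hd : 1 < d) {n : ℕ} [NeZero n] {w : Fin n → ℝ}
    (hw : Antitone w) :
    ∑ s : Fin n, (rankProb d n s - 1 / n) * w s ≤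
      -((1 - (1 / 2 : ℝ) ^ (d - 1)) / n * ∑ s : Fin n, halfSign n s * w s) := by
  set ε := 1 - (1 / 2 : ℝ) ^ (d - 1) with hε
  have hn0 : 0 < n := Nat.pos_of_ne_zero (NeZero.ne n)
  have hn : (0 : ℝ) < n := by exact_mod_cast hn0
  let W : ℕ → ℝ := fun i => w ⟨min i (n - 1), by omega⟩
  have hW : Antitone W := fun i j h => hw (by simp only [Fin.mk_le_mk]; omega)
  have hwW : ∀ s : Fin n, w s = W s := fun s => by
    simp only [W]; congr 1; ext; simp only; omega
  let e : ℕ → ℝ := fun s => (rankProb d n s - 1 / n) + ε / n * halfSign n s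
  have hpre : ∀ i, i ≤ n → ∑ s ∈ Finset.range i, e s
      = (((i : ℝ) / n) ^ d - (i : ℝ) / n) + ε / n * ((min i (n - i) : ℕ) : ℝ) := by
    intro i hi
    have hd0 : d ≠ 0 := by linarith
    have ht := Finset.sum_range_sub (fun r : ℕ => ((r : ℝ) / n) ^ d) i
    simp only [Finset.sum_sub_distrib] at ht
    simp only [e, Finset.sum_add_distrib, Finset.sum_sub_distrib, ← Finset.mul_sum,
      sum_range_halfSign hi, rankProb]
    rw [ht]
    simp [Real.zero_rpow hd0]
    ring
  have hle : ∀ i ≤ n, ∑ s ∈ Finset.range i, e s ≤ 0 := by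
    intro i hi
    rw [hpre i hi]
    have hi' : (i : ℝ) ≤ n := by exact_mod_cast hi
    have h := sub_rpow_ge hd (u := (i : ℝ) / n) (by positivity) ((div_le_one hn).2 hi')
    have h2 : ((min i (n - i) : ℕ) : ℝ) / n = min ((i : ℝ) / n) (1 - (i : ℝ) / n) := by
      rw [Nat.cast_min, Nat.cast_sub hi, ← min_div_div_right hn.le, sub_div, div_self hn.ne']
    have h3 : ε / n * ((min i (n - i) : ℕ) : ℝ) = ε * min ((i : ℝ) / n) (1 - (i : ℝ) / n) := by
      rw [← h2]; ring
    rw [h3]; linarith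
  have hmain := sum_mul_le_of_prefix_nonpos e W hW n hle
  have htot : ∑ s ∈ Finset.range n, e s = 0 := by
    rw [hpre n le_rfl]; simp [hn.ne']
  rw [htot, zero_mul, ← Fin.sum_univ_eq_sum_range (fun s => e s * W s)] at hmain
  have hsplit : ∑ s : Fin n, e s * W s = ∑ s : Fin n, (rankProb d n s - 1 / n) * w s
      + ε / n * ∑ s : Fin n, halfSign n s * w s := by
    rw [Finset.mul_sum, ← Finset.sum_add_distrib]
    exact Finset.sum_congr rfl fun s _ => by rw [hwW]; simp only [e]; ring
  linarith

/-- κ is the slope of the chord of sinh from 0 to m; sinh is convex on [0, ∞). -/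
theorem exists_sinh_chord {m : ℝ} (hm : 0 ≤ m) : ∃ κ : ℝ, 0 ≤ κ ∧ κ * m = Real.sinh m ∧
    (∀ y, 0 ≤ y → y ≤ m → Real.sinh y ≤ κ * y) ∧ ∀ y, m ≤ y → κ * y ≤ Real.sinh y := by
  rcases hm.eq_or_lt with rfl | hm
  · refine ⟨0, le_rfl, by simp, fun y h1 h2 => ?_, fun y h => ?_⟩
    · rw [le_antisymm h2 h1]; simp
    · simpa using Real.sinh_nonneg_iff.2 h
  have hconv : ConvexOn ℝ (Set.Ici 0) Real.sinh := by
    refine MonotoneOn.convexOn_of_deriv (convex_Ici 0) Real.continuous_sinh.continuousOn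
      Real.differentiable_sinh.differentiableOn ?_
    rw [Real.deriv_sinh, interior_Ici]
    exact Real.cosh_strictMonoOn.monotoneOn.mono Set.Ioi_subset_Ici_self
  have key : ∀ y z, 0 ≤ y → y ≤ z → 0 < z → Real.sinh y * z ≤ Real.sinh z * y := by
    intro y z hy hyz hz
    have hc := hconv.2 (show z ∈ Set.Ici 0 from hz.le) (show (0 : ℝ) ∈ Set.Ici 0 by simp)
      (show 0 ≤ y / z by positivity)
      (show 0 ≤ 1 - y / z by linarith [(div_le_one hz).2 hyz]) (by ring)
    simp only [smul_eq_mul, mul_zero, add_zero, Real.sinh_zero, div_mul_cancel₀ _ hz.ne'] at hc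
    calc _ ≤ y / z * Real.sinh z * z := by gcongr
      _ = _ := by field_simp
  have hs := Real.sinh_nonneg_iff.2 hm.le
  refine ⟨Real.sinh m / m, by positivity, by field_simp, fun y h1 h2 => ?_, fun y h => ?_⟩
  · rw [div_mul_eq_mul_div, le_div_iff₀ hm]; exact key y m h1 h2 hm
  · rw [div_mul_eq_mul_div, div_le_iff₀ hm]; exact key m y hm.le h (by linarith)

/-- A Lagrangian form: sinh m and κ/2 are multipliers for the constraints Σσ = 0 and Σy = 0, so the
left side vanishes after summation. -/
theorem sinh_tradeoff {m κ σ y : ℝ} (hm : 0 ≤ m) (hκ : 0 ≤ κ) (hκm : κ * m = Real.sinh m)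
    (h1 : ∀ y, 0 ≤ y → y ≤ m → Real.sinh y ≤ κ * y) (h2 : ∀ y, m ≤ y → κ * y ≤ Real.sinh y)
    (hσ : (σ = 1 ∧ m ≤ y) ∨ (σ = -1 ∧ y ≤ m) ∨ (σ = 0 ∧ y = m)) :
    Real.sinh m * σ - κ / 2 * y ≤ σ * Real.sinh y - 1 / 2 * Real.sinh |y| := by
  rcases hσ with ⟨rfl, h⟩ | ⟨rfl, h⟩ | ⟨rfl, rfl⟩
  · rw [abs_of_nonneg (hm.trans h)]
    nlinarith [h2 y h]
  · rcases le_total 0 y with hy | hy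
    · rw [abs_of_nonneg hy]
      nlinarith [h1 y hy h, mul_le_mul_of_nonneg_left h hκ]
    · rw [abs_of_nonpos hy, Real.sinh_neg]
      rcases le_total (-y) m with hv | hv
      · have := Real.sinh_nonpos_iff.2 hy
        nlinarith [mul_le_mul_of_nonneg_left hv hκ, Real.sinh_nonneg_iff.2 hm]
      · have := h2 (-y) hv
        rw [Real.sinh_neg] at this
        nlinarith [Real.sinh_nonneg_iff.2 hm]
  · rw [abs_of_nonneg hm]; linarith

theorem half_sum_sinh_abs_le_of_nonneg {ι : Type*} [Fintype ι] {σ y : ι → ℝ} {m : ℝ}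
    (hm : 0 ≤ m)
    (hσ : ∀ s, (σ s = 1 ∧ m ≤ y s) ∨ (σ s = -1 ∧ y s ≤ m) ∨ (σ s = 0 ∧ y s = m))
    (hσ0 : ∑ s, σ s = 0) (hy0 : ∑ s, y s = 0) :
    1 / 2 * ∑ s, Real.sinh |y s| ≤ ∑ s, σ s * Real.sinh (y s) := by
  obtain ⟨κ, hκ, hκm, h1, h2⟩ := exists_sinh_chord hm
  have h := Finset.sum_le_sum fun s (_ : s ∈ Finset.univ) =>
    sinh_tradeoff hm hκ hκm h1 h2 (hσ s)
  simp only [Finset.sum_sub_distrib, ← Finset.mul_sum, hσ0, hy0] at h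
  linarith

theorem half_sum_sinh_abs_le {ι : Type*} [Fintype ι] {σ y : ι → ℝ} {m : ℝ}
    (hσ : ∀ s, (σ s = 1 ∧ m ≤ y s) ∨ (σ s = -1 ∧ y s ≤ m) ∨ (σ s = 0 ∧ y s = m))
    (hσ0 : ∑ s, σ s = 0) (hy0 : ∑ s, y s = 0) :
    1 / 2 * ∑ s, Real.sinh |y s| ≤ ∑ s, σ s * Real.sinh (y s) := by
  rcases le_total 0 m with hm | hm
  · exact half_sum_sinh_abs_le_of_nonneg hm hσ hσ0 hy0
  -- Reflecting both σ and y reduces a negative median to a positive one.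
  · have h := half_sum_sinh_abs_le_of_nonneg (σ := fun s => -σ s) (y := fun s => -y s)
      (m := -m) (by linarith) (fun s => ?_) (by simp [hσ0]) (by simp [hy0])
    · simpa [Real.sinh_neg] using h
    · rcases hσ s with h | h | h
      · right; left; simpa using h
      · left; exact ⟨by simp [h.1], by simpa using h.2⟩
      · right; right; simpa using h

theorem half_sum_sinh_abs_le_of_antitone {n : ℕ} [NeZero n] {y : Fin n → ℝ} (hy : Antitone y)
    (hy0 : ∑ s, y s = 0) :
    1 / 2 * ∑ s, Real.sinh |y s| ≤ ∑ s : Fin n, halfSign n s * Real.sinh (y s) := by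
  have hn0 : 0 < n := Nat.pos_of_ne_zero (NeZero.ne n)
  refine half_sum_sinh_abs_le (m := y ⟨n / 2, by omega⟩) (fun s => ?_) ?_ hy0
  · by_cases h1 : (s : ℕ) < n / 2
    · left
      have h2 : ¬ n - n / 2 ≤ (s : ℕ) := by omega
      exact ⟨by simp [halfSign, h1, h2], hy (by rw [Fin.le_def]; exact h1.le)⟩
    · right
      by_cases h2 : n - n / 2 ≤ (s : ℕ)
      · left
        exact ⟨by simp [halfSign, h1, h2], hy (by rw [Fin.le_def]; simp; omega)⟩
      · right
        exact ⟨by simp [halfSign, h1, h2], by congr 1; ext; simp; omega⟩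
  · rw [Fin.sum_univ_eq_sum_range (fun s => halfSign n s), sum_range_halfSign le_rfl]
    simp

theorem normLoad_addBall {n : ℕ} (x : Fin n → ℕ) (j i : Fin n) :
    normLoad (addBall x j) i = normLoad x i + ((if i = j then 1 else 0) - 1 / n) := by
  have h : ∑ k, (addBall x j k : ℝ) = ∑ k, (x k : ℝ) + 1 := by exact_mod_cast sum_addBall x j
  rw [normLoad, normLoad, h, add_div]
  by_cases hij : i = j
  · subst hij; simp [addBall]; ring
  · simp [addBall, hij]; ring

theorem sum_normLoad {n : ℕ} [NeZero n] (x : Fin n → ℕ) : ∑ i, normLoad x i = 0 := by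
  have hn : (n : ℝ) ≠ 0 := Nat.cast_ne_zero.mpr (NeZero.ne n)
  simp only [normLoad, Finset.sum_sub_distrib, Finset.sum_const, Finset.card_univ,
    Fintype.card_fin, nsmul_eq_mul]
  field_simp
  simp

theorem sum_binOfRank {n : ℕ} (x : Fin n → ℕ) (f : Fin n → ℝ) :
    ∑ r, f (binOfRank x r) = ∑ i, f i :=
  Equiv.sum_comp (Tuple.sort fun i => OrderDual.toDual (x i)) f

theorem binOfRank_injective {n : ℕ} (x : Fin n → ℕ) : Function.Injective (binOfRank x) :=
  (Tuple.sort fun i => OrderDual.toDual (x i)).injective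

theorem antitone_normLoad_binOfRank {n : ℕ} (x : Fin n → ℕ) :
    Antitone fun r => normLoad x (binOfRank x r) := fun r s h => by
  have : (x (binOfRank x s) : ℝ) ≤ x (binOfRank x r) := by
    exact_mod_cast antitone_binOfRank x h
  simp only [normLoad]; linarith

/-- Expand e^u ≤ 1 + u + u² for the increments 1 - 1/n and -1/n. The sign of a is free, so both
halves of the potential are covered. -/
theorem stepExp_sum_exp_le {d : ℝ} (hd : 1 < d) {n : ℕ} [NeZero n] {a : ℝ} (ha : |a| ≤ 1)
    (x : Fin n → ℕ) :
    stepExp d (fun x => ∑ i, Real.exp (a * normLoad x i)) x ≤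
      (1 + a ^ 2 * ((d + 1) / n)) * ∑ i, Real.exp (a * normLoad x i)
      + a * ∑ s : Fin n, (rankProb d n s - 1 / n) *
          Real.exp (a * normLoad x (binOfRank x s)) := by
  have hn0 : 0 < n := Nat.pos_of_ne_zero (NeZero.ne n)
  have hn1 : (1 : ℝ) ≤ n := by exact_mod_cast hn0
  have hn : (0 : ℝ) < n := by linarith
  have hinv : (1 : ℝ) / n ≤ 1 := by rw [div_le_one hn]; exact hn1
  have hinv0 : (0 : ℝ) ≤ 1 / n := by positivity
  have hstep : stepExp d (fun x => ∑ i, Real.exp (a * normLoad x i)) x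
      = ∑ s : Fin n, Real.exp (a * normLoad x (binOfRank x s)) *
        ∑ r : Fin n, rankProb d n r * Real.exp (a * ((if s = r then 1 else 0) - 1 / n)) := by
    simp only [stepExp]
    have : ∀ r : Fin n, ∑ i, Real.exp (a * normLoad (addBall x (binOfRank x r)) i)
        = ∑ s : Fin n, Real.exp (a * normLoad x (binOfRank x s)) *
          Real.exp (a * ((if s = r then 1 else 0) - 1 / n)) := by
      intro r
      rw [← sum_binOfRank x]
      refine Finset.sum_congr rfl fun s _ => ?_
      rw [normLoad_addBall, mul_add, Real.exp_add]
      simp only [(binOfRank_injective x).eq_iff]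
    simp only [this, Finset.mul_sum]
    rw [Finset.sum_comm]
    exact Finset.sum_congr rfl fun s _ => Finset.sum_congr rfl fun r _ => by ring
  have hinner : ∀ s : Fin n,
      ∑ r : Fin n, rankProb d n r * Real.exp (a * ((if s = r then 1 else 0) - 1 / n))
        ≤ 1 + a ^ 2 * ((d + 1) / n) + a * (rankProb d n s - 1 / n) := by
    intro s
    have hexp : ∀ u : ℝ, |u| ≤ 1 → Real.exp u ≤ 1 + u + u ^ 2 := fun u hu => by
      have := (abs_le.1 (Real.abs_exp_sub_one_sub_id_le hu)).2
      linarith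
    calc _ ≤ ∑ r : Fin n, rankProb d n r * ((1 - a * (1 / n) + a ^ 2 * (1 / n) ^ 2)
            + (if s = r then a + a ^ 2 * (1 - 2 * (1 / n)) else 0)) := by
          refine Finset.sum_le_sum fun r _ =>
            mul_le_mul_of_nonneg_left ?_ (rankProb_nonneg hd n r)
          refine (hexp _ ?_).trans (le_of_eq ?_)
          · rw [abs_mul]
            refine mul_le_one₀ ha (abs_nonneg _) ?_
            split_ifs <;> rw [abs_le] <;> constructor <;> linarith
          · split_ifs <;> ring
      _ = (1 - a * (1 / n) + a ^ 2 * (1 / n) ^ 2)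
            + rankProb d n s * (a + a ^ 2 * (1 - 2 * (1 / n))) := by
          simp only [mul_add (rankProb d n _), Finset.sum_add_distrib, ← Finset.sum_mul,
            sum_rankProb_real hd n, mul_ite, mul_zero, Finset.sum_ite_eq, Finset.mem_univ,
            if_true, one_mul]
      _ ≤ _ := by
          have h1 : rankProb d n s * (1 - 2 * (1 / n)) ≤ d / n := by
            have := rankProb_le hd s.2
            have := rankProb_nonneg hd n s
            nlinarith
          have h2 : ((1 : ℝ) / n) ^ 2 ≤ 1 / n := by nlinarith
          have h3 : (d + 1) / n = d / n + 1 / n := by ring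
          rw [h3]
          nlinarith [sq_nonneg a]
  rw [hstep]
  calc _ ≤ ∑ s : Fin n, Real.exp (a * normLoad x (binOfRank x s)) *
        (1 + a ^ 2 * ((d + 1) / n) + a * (rankProb d n s - 1 / n)) :=
        Finset.sum_le_sum fun s _ => mul_le_mul_of_nonneg_left (hinner s) (Real.exp_nonneg _)
    _ = _ := by
      rw [← sum_binOfRank x (fun i => Real.exp (a * normLoad x i)), Finset.mul_sum,
        Finset.mul_sum, ← Finset.sum_add_distrib]
      exact Finset.sum_congr rfl fun s _ => by ring

/-- The two-sided exponential potential. -/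
def potential (a : ℝ) {n : ℕ} (x : Fin n → ℕ) : ℝ :=
  ∑ i, Real.exp (a * normLoad x i) + ∑ i, Real.exp (-a * normLoad x i)

theorem stepExp_potential_le {d : ℝ} (hd : 1 < d) {n : ℕ} [NeZero n] {a : ℝ} (ha0 : 0 < a)
    (ha : a ≤ 1) (x : Fin n → ℕ) :
    stepExp d (potential a) x ≤
      (1 + (a ^ 2 * (d + 1) - a * (1 - (1 / 2 : ℝ) ^ (d - 1)) / 2) / n) * potential a x
        + a * (1 - (1 / 2 : ℝ) ^ (d - 1)) := by
  set ε := 1 - (1 / 2 : ℝ) ^ (d - 1) with hε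
  have hε0 : 0 ≤ ε := by
    have : (1 / 2 : ℝ) ^ (d - 1) ≤ 1 :=
      Real.rpow_le_one (by norm_num) (by norm_num) (by linarith)
    linarith
  have hn : (0 : ℝ) < n := by exact_mod_cast Nat.pos_of_ne_zero (NeZero.ne n)
  have habs : |a| ≤ 1 := by rwa [abs_of_pos ha0]
  have hy := antitone_normLoad_binOfRank x
  have h1 := stepExp_sum_exp_le hd habs x
  have h2 := stepExp_sum_exp_le hd (a := -a) (by rwa [abs_neg]) x
  have hw1 := sum_rankProb_mul_le hd (w := fun s => Real.exp (a * normLoad x (binOfRank x s)))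
    fun r s h => Real.exp_le_exp.2 (mul_le_mul_of_nonneg_left (hy h) ha0.le)
  have hw2 := sum_rankProb_mul_le hd
    (w := fun s => -Real.exp (-a * normLoad x (binOfRank x s)))
    fun r s h => neg_le_neg (Real.exp_le_exp.2
      (mul_le_mul_of_nonpos_left (hy h) (by linarith)))
  have hsinh := half_sum_sinh_abs_le_of_antitone
    (y := fun s => a * normLoad x (binOfRank x s))
    (fun r s h => mul_le_mul_of_nonneg_left (hy h) ha0.le)
    (by rw [← Finset.mul_sum, sum_binOfRank x, sum_normLoad, mul_zero])
  -- This loses only e^(-|z|) ≤ 1 per bin; the resulting 2n becomes the additive constant aε of the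
  -- drift.
  have hpot : potential a x - 2 * n ≤ 2 * ∑ s, Real.sinh |a * normLoad x (binOfRank x s)| := by
    have hpt : ∀ z : ℝ, Real.exp z + Real.exp (-z) - 2 ≤ 2 * Real.sinh |z| := by
      intro z
      have key : ∀ w : ℝ, 0 ≤ w → Real.exp w + Real.exp (-w) - 2 ≤ 2 * Real.sinh w := by
        intro w hw
        have : Real.exp (-w) ≤ 1 := Real.exp_le_one_iff.2 (by linarith)
        rw [Real.sinh_eq]; linarith
      rcases le_total 0 z with hz | hz
      · rw [abs_of_nonneg hz]; exact key z hz
      · rw [abs_of_nonpos hz]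
        have := key (-z) (by linarith)
        rw [neg_neg] at this; linarith
    have := Finset.sum_le_sum fun s (_ : s ∈ (Finset.univ : Finset (Fin n))) =>
      hpt (a * normLoad x (binOfRank x s))
    rw [sum_binOfRank x fun i => Real.exp (a * normLoad x i) + Real.exp (-(a * normLoad x i)) - 2,
      ← Finset.mul_sum] at this
    simp only [Finset.sum_sub_distrib, Finset.sum_add_distrib, Finset.sum_const,
      Finset.card_univ, Fintype.card_fin, nsmul_eq_mul, ← neg_mul] at this
    simp only [potential]; linarith
  have hsub : ∑ s : Fin n, halfSign n s * Real.exp (a * normLoad x (binOfRank x s))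
      + ∑ s : Fin n, halfSign n s * -Real.exp (-a * normLoad x (binOfRank x s))
      = 2 * ∑ s : Fin n, halfSign n s * Real.sinh (a * normLoad x (binOfRank x s)) := by
    rw [Finset.mul_sum, ← Finset.sum_add_distrib]
    exact Finset.sum_congr rfl fun s _ => by rw [Real.sinh_eq, neg_mul]; ring
  have hadd : stepExp d (potential a) x
      = stepExp d (fun x => ∑ i, Real.exp (a * normLoad x i)) x
        + stepExp d (fun x => ∑ i, Real.exp (-a * normLoad x i)) x :=
    congrFun (stepExp_add d (fun x : Fin n → ℕ => ∑ i, Real.exp (a * normLoad x i))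
      fun x => ∑ i, Real.exp (-a * normLoad x i)) x
  rw [hadd]
  simp only [mul_neg, Finset.sum_neg_distrib] at hw2 hsub
  set S1 := ∑ s : Fin n, (rankProb d n s - 1 / n) * Real.exp (a * normLoad x (binOfRank x s))
  set S2 := ∑ s : Fin n, (rankProb d n s - 1 / n) * Real.exp (-a * normLoad x (binOfRank x s))
  set H1 := ∑ s : Fin n, halfSign n s * Real.exp (a * normLoad x (binOfRank x s))
  set H2 := ∑ s : Fin n, halfSign n s * Real.exp (-a * normLoad x (binOfRank x s))
  have hdrift : a * S1 + -a * S2 ≤ -(a * ε / n * ((potential a x - 2 * n) / 2)) := by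
    have h3 : S1 - S2 ≤ -(ε / n * (H1 - H2)) := by linarith
    have h4 : (potential a x - 2 * n) / 2 ≤ H1 - H2 := by linarith
    have h5 := mul_le_mul_of_nonneg_left h4 (by positivity : 0 ≤ a * ε / n)
    have h6 := mul_le_mul_of_nonneg_left h3 ha0.le
    calc _ = a * (S1 - S2) := by ring
      _ ≤ a * -(ε / n * (H1 - H2)) := h6
      _ = -(a * ε / n * (H1 - H2)) := by ring
      _ ≤ _ := by linarith
  have hfin : (1 + (a ^ 2 * (d + 1) - a * ε / 2) / n) * potential a x + a * ε
      = (1 + a ^ 2 * ((d + 1) / n)) * potential a x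
        + -(a * ε / n * ((potential a x - 2 * n) / 2)) := by
    field_simp; ring
  rw [hfin]
  have hp : potential a x = ∑ i, Real.exp (a * normLoad x i)
    + ∑ i, Real.exp (-a * normLoad x i) := rfl
  rw [neg_sq] at h2
  rw [hp, mul_add]
  rw [hp] at hdrift
  linarith

theorem exists_potentialBound {d : ℝ} (hd : 1 < d) : ∃ a b : ℝ, PotentialBound hd a b := by
  set ε := 1 - (1 / 2 : ℝ) ^ (d - 1) with hε
  have hε0 : 0 < ε := by
    have : (1 / 2 : ℝ) ^ (d - 1) < 1 :=
      Real.rpow_lt_one (by norm_num) (by norm_num) (by linarith)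
    linarith
  have hε1 : ε ≤ 1 := by
    have : 0 ≤ (1 / 2 : ℝ) ^ (d - 1) := by positivity
    linarith
  -- With this a the quadratic error a²(d + 1) is half of the drift aε/2.
  set a := ε / (4 * (d + 1)) with ha
  have ha0 : 0 < a := by positivity
  have ha4 : a * (d + 1) = ε / 4 := by rw [ha]; field_simp
  have ha1 : a ≤ 1 := by nlinarith
  -- The drift recursion has fixed point 4n, and the empty allocation starts at 2n.
  refine ⟨a, 4, ha0, 0, fun n _ _ t => ?_⟩
  have hn1 : (1 : ℝ) ≤ n := by exact_mod_cast Nat.pos_of_ne_zero (NeZero.ne n)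
  have hn : (0 : ℝ) < n := by linarith
  rw [lintegral_allocationAt hd n t _ fun x => Finset.sum_nonneg fun i _ => Real.exp_nonneg _]
  refine ENNReal.ofReal_le_ofReal ?_
  have hle : ∀ y : Fin n → ℕ, ∑ i, Real.exp (a * |normLoad y i|) ≤ potential a y := by
    intro y
    rw [potential, ← Finset.sum_add_distrib]
    refine Finset.sum_le_sum fun i _ => ?_
    rcases abs_choice (normLoad y i) with h | h <;> rw [h]
    · linarith [Real.exp_nonneg (-a * normLoad y i)]
    · rw [mul_neg, ← neg_mul]; linarith [Real.exp_nonneg (a * normLoad y i)]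
  refine (iterate_stepExp_mono hd _ _ hle).trans ?_
  generalize t * n = m
  set κ := a * ε / 4 / n with hκ
  have hκ1 : κ ≤ 1 := by
    rw [hκ, div_le_one hn]; nlinarith
  induction m with
  | zero => simp [potential, normLoad]; linarith
  | succ m ih =>
    rw [Function.iterate_succ_apply]
    have hstep : ∀ y : Fin n → ℕ,
        stepExp d (potential a) y ≤ (1 - κ) * potential a y + 4 * n * κ := by
      intro y
      refine (stepExp_potential_le hd ha0 ha1 y).trans (le_of_eq ?_)
      have : (a ^ 2 * (d + 1) - a * ε / 2) / n = -κ := by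
        rw [hκ, show a ^ 2 * (d + 1) = a * (a * (d + 1)) by ring, ha4]; ring
      rw [this, hκ]; field_simp; ring
    refine (iterate_stepExp_mono hd _ _ hstep).trans ?_
    rw [iterate_stepExp_add d m (fun y : Fin n → ℕ => (1 - κ) * potential a y)
      (fun _ => 4 * n * κ), iterate_stepExp_const_mul, iterate_stepExp_const hd]
    nlinarith

/-! ### Layered induction. -/

/-- The number of bins with at least `h` balls. -/
def heavyCount {n : ℕ} (h : ℕ) (x : Fin n → ℕ) : ℕ := (Finset.univ.filter fun i => h ≤ x i).card

/-- The number of balls above height `h`. -/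
def excess {n : ℕ} (h : ℕ) (x : Fin n → ℕ) : ℕ := ∑ i, (x i - h)

/-- Bins of load at least h occupy exactly the first `heavyCount h x` ranks, so their probabilities
telescope. -/
theorem sum_rankProb_heavy_le {d : ℝ} (hd : 1 < d) {n : ℕ} (h : ℕ) (x : Fin n → ℕ) :
    ∑ r : Fin n, (if h ≤ x (binOfRank x r) then rankProb d n r else 0)
      ≤ ((heavyCount h x : ℝ) / n) ^ d := by
  set c := heavyCount h x with hc
  have hcard : (Finset.univ.filter fun r => h ≤ x (binOfRank x r)).card = c := by
    rw [hc, heavyCount, ← Finset.card_map ⟨binOfRank x, binOfRank_injective x⟩]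
    congr 1
    ext i
    simp only [Finset.mem_map, Finset.mem_filter, Finset.mem_univ, true_and,
      Function.Embedding.coeFn_mk]
    constructor
    · rintro ⟨r, hr, rfl⟩; exact hr
    · intro hi
      obtain ⟨r, rfl⟩ := (Tuple.sort fun i => OrderDual.toDual (x i)).surjective i
      exact ⟨r, hi, rfl⟩
  have hlt : ∀ r : Fin n, h ≤ x (binOfRank x r) → (r : ℕ) < c := by
    intro r hr
    have hsub : Finset.Iic r ⊆ Finset.univ.filter fun r => h ≤ x (binOfRank x r) := by
      intro s hs
      simp only [Finset.mem_filter, Finset.mem_univ, true_and]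
      exact hr.trans (antitone_binOfRank x (Finset.mem_Iic.1 hs))
    have := Finset.card_le_card hsub
    rw [hcard, Fin.card_Iic] at this
    omega
  have hcn : c ≤ n := by
    rw [hc, heavyCount]
    exact (Finset.card_le_univ _).trans_eq (Fintype.card_fin n)
  have hd0 : d ≠ 0 := by linarith
  calc _ ≤ ∑ r : Fin n, if (r : ℕ) < c then rankProb d n r else 0 := by
        refine Finset.sum_le_sum fun r _ => ?_
        by_cases h1 : h ≤ x (binOfRank x r)
        · simp [h1, hlt r h1]
        · rw [if_neg h1]
          split_ifs
          · exact rankProb_nonneg hd n r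
          · exact le_rfl
    _ = ∑ r ∈ Finset.range c, rankProb d n r := by
        rw [Fin.sum_univ_eq_sum_range (fun r => if r < c then rankProb d n r else 0),
          ← Finset.sum_filter]
        congr 1
        ext r
        simp only [Finset.mem_filter, Finset.mem_range]
        omega
    _ = _ := by
        unfold rankProb
        rw [Finset.sum_range_sub (fun r : ℕ => ((r : ℝ) / n) ^ d)]
        simp [Real.zero_rpow hd0]

theorem le_addBall {n : ℕ} (x : Fin n → ℕ) (j i : Fin n) : x i ≤ addBall x j i := by
  by_cases hij : i = j
  · subst hij; simp [addBall]
  · simp [addBall, hij]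

theorem heavyCount_le_addBall {n : ℕ} (h : ℕ) (x : Fin n → ℕ) (j : Fin n) :
    heavyCount h x ≤ heavyCount h (addBall x j) := by
  refine Finset.card_le_card fun i hi => ?_
  simp only [Finset.mem_filter, Finset.mem_univ, true_and] at hi ⊢
  exact hi.trans (le_addBall x j i)

theorem excess_addBall {n : ℕ} (h : ℕ) (x : Fin n → ℕ) (j : Fin n) :
    excess h (addBall x j) = excess h x + if h ≤ x j then 1 else 0 := by
  have : ∀ i, addBall x j i - h
      = (x i - h) + if i = j then (if h ≤ x j then 1 else 0) else 0 := by
    intro i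
    by_cases hij : i = j
    · subst hij
      simp only [addBall, Function.update_self, if_true]
      split_ifs <;> omega
    · simp [addBall, hij]
  simp [excess, this, Finset.sum_add_distrib]

theorem heavyCount_succ_le_excess {n : ℕ} (h : ℕ) (x : Fin n → ℕ) :
    heavyCount (h + 1) x ≤ excess h x := by
  rw [heavyCount, Finset.card_filter]
  refine Finset.sum_le_sum fun i _ => ?_
  split_ifs <;> omega

theorem le_excess_of_le {n : ℕ} {h r : ℕ} {x : Fin n → ℕ} {i : Fin n} (hi : h + r ≤ x i) :
    r ≤ excess h x :=
  (by omega : r ≤ x i - h).trans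
    (Finset.single_le_sum (f := fun i => x i - h) (fun _ _ => Nat.zero_le _) (Finset.mem_univ i))

/-- The exponential weight of the balls above height `h`, killed once more than `m` bins reach
height `h`. -/
def layerWeight {n : ℕ} (l m : ℝ) (h : ℕ) (x : Fin n → ℕ) : ℝ :=
  if (heavyCount h x : ℝ) ≤ m then l ^ excess h x else 0

theorem layerWeight_nonneg {n : ℕ} {l : ℝ} (hl : 1 ≤ l) (m : ℝ) (h : ℕ) (x : Fin n → ℕ) :
    0 ≤ layerWeight l m h x := by
  unfold layerWeight
  split_ifs <;> positivity

/-- Since `heavyCount` never decreases, killing is permanent. A bound on the final count can thus be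
used at every step without conditioning on the future. -/
theorem stepExp_layerWeight_le {d : ℝ} (hd : 1 < d) {n : ℕ} [NeZero n] {l m : ℝ} (hl : 1 ≤ l)
    (h : ℕ) (x : Fin n → ℕ) :
    stepExp d (layerWeight l m h) x ≤ (1 + l * (m / n) ^ d) * layerWeight l m h x := by
  by_cases hm : (heavyCount h x : ℝ) ≤ m
  · have hw : layerWeight l m h x = l ^ excess h x := by simp [layerWeight, hm]
    have hle : ∀ j, layerWeight l m h (addBall x j) ≤
        l ^ excess h x * (1 + if h ≤ x j then l else 0) := by
      intro j
      have hp : (0 : ℝ) ≤ l ^ excess h x := by positivity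
      have : layerWeight l m h (addBall x j) ≤ l ^ excess h (addBall x j) := by
        unfold layerWeight
        split_ifs
        · exact le_rfl
        · positivity
      refine this.trans ?_
      rw [excess_addBall, pow_add]
      refine mul_le_mul_of_nonneg_left ?_ hp
      split_ifs <;> simp
    calc _ ≤ ∑ r : Fin n, rankProb d n r *
            (l ^ excess h x * (1 + if h ≤ x (binOfRank x r) then l else 0)) :=
          Finset.sum_le_sum fun r _ =>
            mul_le_mul_of_nonneg_left (hle _) (rankProb_nonneg hd n r)
      _ = (1 + l * ∑ r : Fin n, (if h ≤ x (binOfRank x r) then rankProb d n r else 0))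
            * l ^ excess h x := by
          rw [← sum_rankProb_real hd n, Finset.mul_sum, ← Finset.sum_add_distrib,
            Finset.sum_mul]
          refine Finset.sum_congr rfl fun r _ => ?_
          rw [sum_rankProb_real hd n]
          split_ifs <;> ring
      _ ≤ _ := by
          rw [hw]
          have h1 := sum_rankProb_heavy_le hd h x
          have h2 : ((heavyCount h x : ℝ) / n) ^ d ≤ (m / n) ^ d :=
            Real.rpow_le_rpow (by positivity) (by gcongr) (by linarith)
          have := h1.trans h2
          gcongr
  · have hw : layerWeight l m h x = 0 := by simp [layerWeight, hm]
    rw [hw, mul_zero]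
    refine (Finset.sum_eq_zero fun r _ => ?_).le
    have hlt : m < heavyCount h (addBall x (binOfRank x r)) :=
      (not_le.1 hm).trans_le (by exact_mod_cast heavyCount_le_addBall h x _)
    simp [layerWeight, hlt]

theorem probFrom_layer_le {d : ℝ} (hd : 1 < d) {n : ℕ} [NeZero n] {l m : ℝ} (hl : 1 ≤ l)
    (hm : 0 ≤ m) {h : ℕ} {x : Fin n → ℕ} (hx : ∀ i, x i ≤ h) (M : ℕ) (z : ℝ) :
    probFrom d M x {y | (heavyCount h y : ℝ) ≤ m ∧ z ≤ excess h y} ≤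
      Real.exp (M * (l * (m / n) ^ d)) / l ^ z := by
  have hl0 : 0 < l := by linarith
  refine probFrom_le_of_le hd M (Real.rpow_pos_of_pos hl0 z) (layerWeight_nonneg hl m h)
    (fun y _ hy => ?_) ?_
  · simp only [layerWeight, hy.1, if_true, ← Real.rpow_natCast]
    exact Real.rpow_le_rpow_of_exponent_le hl hy.2
  · set q := l * (m / n) ^ d with hq
    have hq0 : 0 ≤ q := by positivity
    have hpow : (stepExp d)^[M] (layerWeight l m h) x ≤ (1 + q) ^ M * layerWeight l m h x := by
      clear hx
      induction M generalizing x with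
      | zero => simp
      | succ M ih =>
        rw [Function.iterate_succ_apply]
        refine (iterate_stepExp_mono hd M x (stepExp_layerWeight_le hd hl h)).trans ?_
        rw [iterate_stepExp_const_mul, pow_succ', mul_assoc]
        exact mul_le_mul_of_nonneg_left ih (by positivity)
    have hw : layerWeight l m h x ≤ 1 := by
      have : excess h x = 0 := Finset.sum_eq_zero fun i _ => by have := hx i; omega
      unfold layerWeight
      split_ifs <;> simp [this]
    calc _ ≤ (1 + q) ^ M * 1 := hpow.trans (mul_le_mul_of_nonneg_left hw (by positivity))
      _ ≤ Real.exp q ^ M := by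
        rw [mul_one]
        exact pow_le_pow_left₀ (by positivity) (by linarith [Real.add_one_le_exp q]) M
      _ = _ := by rw [← Real.exp_nat_mul]

/-- A union bound over the level at which the chain of bounds first breaks. -/
theorem probFrom_heavyCount_le {d : ℝ} (hd : 1 < d) {n : ℕ} {h M : ℕ} {x : Fin n → ℕ}
    (μ : ℕ → ℝ) {δ : ℝ} (K : ℕ)
    (hδ : ∀ i < K, probFrom d M x
      {y | (heavyCount (h + i) y : ℝ) ≤ μ i ∧ μ (i + 1) ≤ excess (h + i) y} ≤ δ) :
    probFrom d M x {y | (heavyCount h y : ℝ) ≤ μ 0 ∧ μ K < heavyCount (h + K) y} ≤ K * δ := by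
  induction K with
  | zero =>
    have h0 : (fun _ : Fin n → ℕ => (0 : ℝ)) = fun y => 0 * (1 : ℝ) := by simp
    have hz : {y : Fin n → ℕ | (heavyCount h y : ℝ) ≤ μ 0 ∧ μ 0 < heavyCount (h + 0) y} = ∅ := by
      ext y
      simp
    have := congrFun (iterate_stepExp_const_mul d M 0 fun _ : Fin n → ℕ => (0 : ℝ)) x
    simp only [zero_mul] at this
    rw [hz, probFrom, Set.indicator_empty]
    simp [this]
  | succ K ih =>
    have h1 := ih fun i hi => hδ i (by omega)
    have h2 := hδ K (by omega)
    refine (probFrom_mono_of_sum hd M (U := _ ∪ _) fun y _ hy => ?_).trans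
      ((probFrom_union_le hd M x _ _).trans (add_le_add h1 h2) |>.trans (le_of_eq ?_))
    · by_cases hK : (heavyCount (h + K) y : ℝ) ≤ μ K
      · right
        refine ⟨hK, hy.2.le.trans ?_⟩
        exact_mod_cast heavyCount_succ_le_excess (h + K) y
      · left
        exact ⟨hy.1, not_le.1 hK⟩
    · push_cast; ring

theorem probFrom_layers_le {d : ℝ} (hd : 1 < d) {n : ℕ} [NeZero n] {h M : ℕ} {x : Fin n → ℕ}
    (hx : ∀ i, x i ≤ h) {μ : ℕ → ℝ} (hμ : ∀ i, 0 ≤ μ i) {l c : ℝ} (hl : 1 ≤ l) (K r : ℕ)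
    (h1 : ∀ i, 6 * (M * (μ i / n) ^ d) ≤ μ (i + 1)) (h2 : ∀ i, 2 * c ≤ μ (i + 1)) :
    probFrom d M x {y | (heavyCount h y : ℝ) ≤ μ 0 ∧ ∃ i, h + K + r ≤ y i} ≤
      K * Real.exp (-c) + Real.exp (M * (l * (μ K / n) ^ d)) / l ^ (r : ℝ) := by
  have hchain := probFrom_heavyCount_le hd (h := h) (M := M) (x := x) μ (δ := Real.exp (-c)) K
    fun i _ => by
      -- With base e the exponent is eM(μ i / n)^d - μ (i + 1). As e < 3, `h1` makes this at most -μ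
      -- (i + 1) / 2, and `h2` makes that at most -c.
      refine (probFrom_layer_le hd (l := Real.exp 1) (by simp) (hμ i)
        (fun j => (hx j).trans (Nat.le_add_right h i)) M _).trans ?_
      rw [← Real.exp_mul, ← Real.exp_sub, Real.exp_le_exp]
      have he := Real.exp_one_lt_d9
      have hp : 0 ≤ (M : ℝ) * (μ i / n) ^ d :=
        mul_nonneg (Nat.cast_nonneg M) (Real.rpow_nonneg (div_nonneg (hμ i) (Nat.cast_nonneg n)) d)
      nlinarith [h1 i, h2 i]
  have hlast := probFrom_layer_le hd hl (hμ K)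
    (fun j => (hx j).trans (Nat.le_add_right h K)) M r
  refine (probFrom_mono_of_sum hd M (U := _ ∪ _) fun y _ hy => ?_).trans
    ((probFrom_union_le hd M x _ _).trans (add_le_add hchain hlast))
  by_cases hK : (heavyCount (h + K) y : ℝ) ≤ μ K
  · right
    obtain ⟨i, hi⟩ := hy.2
    exact ⟨hK, by exact_mod_cast le_excess_of_le hi⟩
  · left
    exact ⟨hy.1, not_le.1 hK⟩

theorem tendsto_log_natCast : Tendsto (fun n : ℕ => Real.log n) atTop atTop :=
  Real.tendsto_log_atTop.comp tendsto_natCast_atTop_atTop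

theorem eventually_mul_log_rpow_le (c p : ℝ) {s : ℝ} (hs : 0 < s) :
    ∀ᶠ x : ℝ in atTop, c * Real.log x ^ p ≤ x ^ s := by
  have h := (isLittleO_log_rpow_rpow_atTop p hs).const_mul_left c
  filter_upwards [h.bound one_pos, eventually_ge_atTop 0] with x hx hx0
  rw [one_mul, Real.norm_of_nonneg (by positivity : 0 ≤ x ^ s)] at hx
  exact (le_abs_self _).trans hx

theorem eventually_const_mul_log_le (c : ℝ) : ∀ᶠ x : ℝ in atTop, c * Real.log x ≤ x := by
  simpa using eventually_mul_log_rpow_le c 1 one_pos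

/-- The power of w is the fixed point of β ↦ wβ^d; relative to it the logarithm is multiplied by d
at each level. -/
theorem mul_rpow_exp_layer {d : ℝ} (hd : 1 < d) {w : ℝ} (hw : 0 < w) (i : ℕ) :
    w * (Real.exp (-d ^ i) * w ^ (-(1 / (d - 1)))) ^ d
      = Real.exp (-d ^ (i + 1)) * w ^ (-(1 / (d - 1))) := by
  have hd1 : d - 1 ≠ 0 := by linarith
  rw [Real.mul_rpow (Real.exp_nonneg _) (by positivity), ← Real.exp_mul, ← Real.rpow_mul hw.le,
    mul_left_comm, ← Real.rpow_one_add' hw.le]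
  · congr 2
    · ring
    · field_simp; ring
  · intro h
    field_simp at h
    linarith

theorem eventually_probFrom_le {d : ℝ} (hd : 1 < d) (C : ℝ) :
    ∀ᶠ n : ℕ in atTop, ∀ [NeZero n] (L : ℕ), 1 ≤ L → L ≤ C * Real.log n →
      ∀ (h : ℕ) (x : Fin n → ℕ), (∀ i, x i ≤ h) →
        probFrom d (L * n) x {y |
          (heavyCount h y : ℝ) ≤ n * (Real.exp (-1) * (6 * L : ℝ) ^ (-(1 / (d - 1)))) ∧
            ∃ i, h + ⌈Real.logb d (Real.log n)⌉₊ + ⌈24 / (d - 1)⌉₊ ≤ y i} ≤ 1 / (n : ℝ) ^ 11 := by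
  have hd1 : 0 < d - 1 := by linarith
  have hE := tendsto_natCast_atTop_atTop.eventually
    (eventually_mul_log_rpow_le (6 * |C| * 24 ^ d) (d + 1) (half_pos hd1))
  have hK := tendsto_natCast_atTop_atTop.eventually
    (eventually_const_mul_log_le (1 / Real.log d + 4))
  filter_upwards [hE, hK, tendsto_log_natCast.eventually_ge_atTop 1] with n hE hK hlg _ L hL1 hLC
    h x hx
  set lg := Real.log n with hlg'
  have hn1 : (1 : ℝ) ≤ n := by exact_mod_cast Nat.pos_of_ne_zero (NeZero.ne n)
  have hn : (0 : ℝ) < n := by linarith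
  have hlg0 : 0 < lg := by linarith
  have hL : (1 : ℝ) ≤ L := by exact_mod_cast hL1
  have hL0 : (0 : ℝ) < 6 * L := by linarith
  set q := 1 / (d - 1) with hq
  set K := ⌈Real.logb d lg⌉₊ with hKdef
  set r := ⌈24 / (d - 1)⌉₊ with hr
  -- The floor nB = 2 · 12 log n keeps each layer's failure probability below n^(-12).
  set B := 24 * lg / n with hB
  have hB0 : 0 < B := by positivity
  set A : ℕ → ℝ := fun i => Real.exp (-d ^ i) * (6 * L : ℝ) ^ (-q) with hA
  have hA0 : ∀ i, 0 ≤ A i := fun i => by positivity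
  -- Half the exponent d - 1: small enough that Ln · l · B^d ≤ 1, yet large enough that l^r ≥ n^12.
  set l := (n : ℝ) ^ ((d - 1) / 2) with hl
  have hl1 : 1 ≤ l := Real.one_le_rpow hn1 (by linarith)
  have hLB : 6 * L * B ^ d * n ^ d ≤ l := by
    rw [hB, Real.div_rpow (by positivity) hn.le, Real.mul_rpow (by norm_num) hlg0.le]
    have h1 : (L : ℝ) ≤ |C| * lg :=
      hLC.trans (mul_le_mul_of_nonneg_right (le_abs_self C) hlg0.le)
    calc _ = 6 * L * (24 ^ d * lg ^ d) := by field_simp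
      _ ≤ 6 * (|C| * lg) * (24 ^ d * lg ^ d) := by gcongr
      _ = 6 * |C| * 24 ^ d * lg ^ (d + 1) := by rw [Real.rpow_add_one hlg0.ne']; ring
      _ ≤ _ := hE
  have hnd : (n : ℝ) ^ d = l * l * n := by
    rw [hl, ← Real.rpow_add hn, ← Real.rpow_add_one hn.ne']; congr 1; ring
  have hLBl : 6 * L * B ^ d * (l * n) ≤ 1 := by
    rw [hnd] at hLB
    have : (6 * L * B ^ d * (l * n)) * l ≤ 1 * l := by linarith
    exact le_of_mul_le_mul_right this (by linarith)
  have hp0 : 0 ≤ 6 * L * B ^ d := by positivity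
  have hstepB : 6 * L * B ^ d ≤ B := by
    have h1 : 6 * L * B ^ d * n ≤ 1 := by
      refine le_trans ?_ hLBl
      gcongr
      exact le_mul_of_one_le_left hn.le hl1
    rw [hB, le_div_iff₀ hn]; linarith
  have hAK : A K ≤ B := by
    have h1 : lg ≤ d ^ K := by
      rw [← Real.rpow_natCast, ← Real.logb_le_iff_le_rpow hd hlg0]
      exact Nat.le_ceil _
    have h2 : Real.exp (-d ^ K) ≤ 1 / n := by
      rw [one_div, ← Real.exp_log hn, ← Real.exp_neg]
      exact Real.exp_le_exp.2 (neg_le_neg h1)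
    have h3 : (6 * L : ℝ) ^ (-q) ≤ 1 :=
      Real.rpow_le_one_of_one_le_of_nonpos (by linarith) (by rw [hq]; simp; linarith)
    calc A K ≤ 1 / n * 1 := mul_le_mul h2 h3 (by positivity) (by positivity)
      _ ≤ B := by rw [mul_one, hB]; gcongr; linarith
  have hmain := probFrom_layers_le hd hx (μ := fun i => n * max (A i) B) (M := L * n)
    (fun i => by positivity) (l := l) (c := 12 * lg) hl1 K r
    (fun i => by
      have : (n : ℝ) * max (A i) B / n = max (A i) B := by field_simp
      simp only [this]
      push_cast
      rw [show 6 * ((L : ℝ) * n * max (A i) B ^ d) = n * (6 * L * max (A i) B ^ d) by ring]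
      refine mul_le_mul_of_nonneg_left ?_ hn.le
      rcases le_total (A i) B with hAB | hAB
      · rw [max_eq_right hAB]
        exact hstepB.trans (le_max_right _ _)
      · rw [max_eq_left hAB]
        exact (mul_rpow_exp_layer hd hL0 i).le.trans (le_max_left _ _))
    (fun i => by
      have : (n : ℝ) * B = 24 * lg := by rw [hB]; field_simp
      have := mul_le_mul_of_nonneg_left (le_max_right (A (i + 1)) B) hn.le
      linarith)
  simp only [max_eq_right hAK] at hmain
  refine (probFrom_mono_of_sum hd _ fun y _ hy => ?_).trans (hmain.trans ?_)
  · refine ⟨hy.1.trans (mul_le_mul_of_nonneg_left ?_ hn.le), hy.2⟩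
    refine le_trans ?_ (le_max_left _ _)
    simp [hA]
  · have h12 : Real.exp (-(12 * lg)) = 1 / (n : ℝ) ^ 12 := by
      rw [Real.exp_neg, mul_comm, Real.exp_mul, hlg', Real.exp_log hn, one_div]
      congr 1
      exact_mod_cast Real.rpow_natCast (n : ℝ) 12
    have hlr : (n : ℝ) ^ 12 ≤ l ^ (r : ℝ) := by
      rw [hl, ← Real.rpow_mul hn.le, ← Real.rpow_natCast]
      refine Real.rpow_le_rpow_of_exponent_le hn1 ?_
      have h1 : 24 / (d - 1) ≤ r := Nat.le_ceil _
      rw [div_le_iff₀ hd1] at h1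
      push_cast; linarith
    have hexp : Real.exp ((L * n : ℕ) * (l * (n * B / n) ^ d)) ≤ 3 := by
      have : (n : ℝ) * B / n = B := by field_simp
      rw [this]
      have h1 : ((L * n : ℕ) : ℝ) * (l * B ^ d) ≤ 1 := by
        push_cast
        have h0 : 0 ≤ (L : ℝ) * n * (l * B ^ d) := by positivity
        linarith
      exact (Real.exp_le_exp.2 h1).trans (by linarith [Real.exp_one_lt_d9])
    have hKn : (K : ℝ) + 3 ≤ n := by
      have hlogd : 0 < Real.log d := Real.log_pos hd
      have h0 : 0 ≤ Real.logb d lg := Real.logb_nonneg hd hlg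
      have h1 := Nat.ceil_lt_add_one h0
      have h2 : Real.logb d lg ≤ 1 / Real.log d * lg := by
        rw [Real.logb, one_div, inv_mul_eq_div]
        gcongr
        exact (Real.log_le_sub_one_of_pos hlg0).trans (by linarith)
      linarith
    calc _ ≤ (K : ℝ) * (1 / (n : ℝ) ^ 12) + 3 / (n : ℝ) ^ 12 := by
          rw [h12]
          gcongr
      _ = (K + 3) / (n : ℝ) ^ 12 := by ring
      _ ≤ n / (n : ℝ) ^ 12 := by gcongr
      _ = _ := by field_simp

/-! ### From the potential bound to the gap, and the two-phase argument. -/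

theorem exists_normLoad_eq_gap {n : ℕ} [NeZero n] (x : Fin n → ℕ) : ∃ i, normLoad x i = gap x :=
  exists_eq_ciSup_of_finite

theorem normLoad_le_gap {n : ℕ} (x : Fin n → ℕ) (i : Fin n) : normLoad x i ≤ gap x :=
  le_ciSup (Set.finite_range _).bddAbove i

theorem normLoad_of_sum {n : ℕ} [NeZero n] {x : Fin n → ℕ} {t : ℕ} (h : ∑ i, x i = t * n)
    (i : Fin n) : normLoad x i = x i - t := by
  have hn : (n : ℝ) ≠ 0 := Nat.cast_ne_zero.mpr (NeZero.ne n)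
  have h' : ∑ i, (x i : ℝ) = t * n := by exact_mod_cast h
  rw [normLoad, h', mul_div_cancel_right₀ _ hn]

theorem PotentialBound.exists_iterate_le {d : ℝ} {hd : 1 < d} {a b : ℝ}
    (hab : PotentialBound hd a b) : ∃ B : ℝ, 0 < B ∧ ∀ᶠ n : ℕ in atTop, ∀ [NeZero n] (t : ℕ),
      (stepExp d)^[t * n] (fun x : Fin n → ℕ => ∑ i, Real.exp (a * |normLoad x i|)) (fun _ => 0)
        ≤ B * n := by
  obtain ⟨-, N, hN⟩ := hab
  -- Positivity allows `ENNReal.ofReal` to be removed from the inequality.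
  refine ⟨max b 1, by positivity, ?_⟩
  filter_upwards [eventually_ge_atTop N] with n hn _ t
  have h := hN n hn t
  have h0 : ∀ x : Fin n → ℕ, 0 ≤ ∑ i, Real.exp (a * |normLoad x i|) := fun x =>
    Finset.sum_nonneg fun i _ => Real.exp_nonneg _
  rw [lintegral_allocationAt hd n t _ h0] at h
  have h' := h.trans (ENNReal.ofReal_le_ofReal (mul_le_mul_of_nonneg_right (le_max_left b 1)
    (Nat.cast_nonneg n)))
  exact (ENNReal.ofReal_le_ofReal_iff (by positivity)).1 h'

theorem probFrom_gap_ge_le {d : ℝ} (hd : 1 < d) {n : ℕ} [NeZero n] {a B : ℝ} (ha : 0 < a) {t : ℕ}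
    (hB : (stepExp d)^[t * n] (fun x : Fin n → ℕ => ∑ i, Real.exp (a * |normLoad x i|))
      (fun _ => 0) ≤ B) (g : ℝ) :
    probFrom d (t * n) (fun _ : Fin n => 0) {x | g ≤ gap x} ≤ B / Real.exp (a * g) := by
  refine probFrom_le_of_le hd _ (Real.exp_pos _)
    (fun y => Finset.sum_nonneg fun i _ => Real.exp_nonneg _) (fun y _ hy => ?_) hB
  obtain ⟨i, hi⟩ := exists_normLoad_eq_gap y
  have h1 : g ≤ |normLoad y i| := (hi ▸ hy : g ≤ normLoad y i).trans (le_abs_self _)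
  exact (Real.exp_le_exp.2 (mul_le_mul_of_nonneg_left h1 ha.le)).trans
    (Finset.single_le_sum (f := fun i => Real.exp (a * |normLoad y i|))
      (fun i _ => Real.exp_nonneg _) (Finset.mem_univ i))

theorem probFrom_heavyCount_gt_le {d : ℝ} (hd : 1 < d) {n : ℕ} [NeZero n] {a B : ℝ} (ha : 0 < a)
    {t : ℕ} (hB : (stepExp d)^[t * n] (fun x : Fin n → ℕ => ∑ i, Real.exp (a * |normLoad x i|))
      (fun _ => 0) ≤ B) (g : ℝ) {z : ℝ} (hz : 0 < z) :
    probFrom d (t * n) (fun _ : Fin n => 0) {x | z < heavyCount (t + ⌈g⌉₊) x}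
      ≤ B / (z * Real.exp (a * g)) := by
  refine probFrom_le_of_le hd _ (mul_pos hz (Real.exp_pos _))
    (fun y => Finset.sum_nonneg fun i _ => Real.exp_nonneg _) (fun y hsum hy => ?_) hB
  have hsum' : ∑ i, y i = t * n := by simpa using hsum
  calc z * Real.exp (a * g) ≤ heavyCount (t + ⌈g⌉₊) y * Real.exp (a * g) := by
        have : z < heavyCount (t + ⌈g⌉₊) y := hy
        gcongr
    _ = ∑ i ∈ Finset.univ.filter (fun i => t + ⌈g⌉₊ ≤ y i), Real.exp (a * g) := by
        rw [Finset.sum_const, nsmul_eq_mul, heavyCount]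
    _ ≤ ∑ i ∈ Finset.univ.filter (fun i => t + ⌈g⌉₊ ≤ y i), Real.exp (a * |normLoad y i|) := by
        refine Finset.sum_le_sum fun i hi => Real.exp_le_exp.2 ?_
        refine mul_le_mul_of_nonneg_left (le_trans ?_ (le_abs_self _)) ha.le
        rw [normLoad_of_sum hsum']
        have h1 : ((t + ⌈g⌉₊ : ℕ) : ℝ) ≤ y i := by exact_mod_cast (Finset.mem_filter.1 hi).2
        push_cast at h1
        linarith [Nat.le_ceil g]
    _ ≤ _ := Finset.sum_le_sum_of_subset_of_nonneg (Finset.filter_subset _ _)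
        fun i _ _ => Real.exp_nonneg _

/-- A gap of at most `L` is reduced to about `log_d (log n)` by the next `L * n` balls. -/
theorem eventually_gap_reduction {d : ℝ} (hd : 1 < d) {a B : ℝ} (ha : 0 < a)
    (hB : ∀ᶠ n : ℕ in atTop, ∀ [NeZero n] (t : ℕ),
      (stepExp d)^[t * n] (fun x : Fin n → ℕ => ∑ i, Real.exp (a * |normLoad x i|)) (fun _ => 0)
        ≤ B * n) (C : ℝ) :
    ∀ᶠ n : ℕ in atTop, ∀ [NeZero n] (t L : ℕ) (g : ℝ), 1 ≤ L → L ≤ C * Real.log n → 0 ≤ g →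
      probFrom d ((t + L) * n) (fun _ : Fin n => 0)
          {x | Real.logb d (Real.log n) + g + (⌈24 / (d - 1)⌉₊ + 2) ≤ gap x} ≤
        probFrom d (t * n) (fun _ : Fin n => 0) {x | (L : ℝ) ≤ gap x} + 1 / (n : ℝ) ^ 11
          + B * Real.exp 1 * (6 * L : ℝ) ^ (1 / (d - 1)) * Real.exp (-(a * g)) := by
  filter_upwards [hB, eventually_probFrom_le hd C, tendsto_log_natCast.eventually_ge_atTop 1]
    with n hB hlayers hlg _ t L g hL1 hLC hg
  have hn : (0 : ℝ) < n := by exact_mod_cast Nat.pos_of_ne_zero (NeZero.ne n)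
  have hL : (1 : ℝ) ≤ L := by exact_mod_cast hL1
  have hL0 : (0 : ℝ) < 6 * L := by linarith
  set z := n * (Real.exp (-1) * (6 * L : ℝ) ^ (-(1 / (d - 1)))) with hz
  have hz0 : 0 < z := by positivity
  -- The potential is used at the final time t + L, which supplies the base of the layers.
  have hheavy := probFrom_heavyCount_gt_le hd ha (hB (t + L)) g hz0
  have hlight := probFrom_add_le hd (t * n) (L * n) (x := fun _ : Fin n => 0)
    (U := {x | (L : ℝ) ≤ gap x}) (S := {y |
      (heavyCount (t + L + ⌈g⌉₊) y : ℝ) ≤ z ∧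
        ∃ i, t + L + ⌈g⌉₊ + ⌈Real.logb d (Real.log n)⌉₊ + ⌈24 / (d - 1)⌉₊ ≤ y i})
    (B := 1 / (n : ℝ) ^ 11) (by positivity) fun y hy hyU => by
      refine hlayers L hL1 hLC _ y fun i => ?_
      have hsum : ∑ i, y i = t * n := by simpa using hy
      have h1 := (normLoad_le_gap y i).trans_lt (not_le.1 hyU)
      rw [normLoad_of_sum hsum] at h1
      have h2 : (y i : ℝ) < ((t + L : ℕ) : ℝ) := by push_cast; linarith
      have : y i < t + L := by exact_mod_cast h2
      omega
  rw [← add_mul] at hlight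
  have hlast : B * n / (z * Real.exp (a * g))
      = B * Real.exp 1 * (6 * L : ℝ) ^ (1 / (d - 1)) * Real.exp (-(a * g)) := by
    rw [hz, Real.rpow_neg hL0.le, Real.exp_neg, Real.exp_neg]
    have : (6 * L : ℝ) ^ (1 / (d - 1)) ≠ 0 := by positivity
    field_simp
  rw [← hlast]
  refine (probFrom_mono_of_sum hd _ (U := _ ∪ _) fun y hy hyS => ?_).trans
    ((probFrom_union_le hd _ _ _ _).trans (add_le_add hlight hheavy))
  by_cases hyz : z < heavyCount (t + L + ⌈g⌉₊) y
  · exact Or.inr hyz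
  · refine Or.inl ⟨not_lt.1 hyz, ?_⟩
    have hsum : ∑ i, y i = (t + L) * n := by simpa using hy
    obtain ⟨i, hi⟩ := exists_normLoad_eq_gap y
    refine ⟨i, ?_⟩
    have h1 : Real.logb d (Real.log n) + g + (⌈24 / (d - 1)⌉₊ + 2) ≤ gap y := hyS
    rw [← hi, normLoad_of_sum hsum] at h1
    have h2 := Nat.ceil_lt_add_one hg
    have h3 := Nat.ceil_lt_add_one (Real.logb_nonneg hd hlg)
    have h4 : ((t + L + ⌈g⌉₊ + ⌈Real.logb d (Real.log n)⌉₊ + ⌈24 / (d - 1)⌉₊ : ℕ) : ℝ)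
        ≤ (y i : ℝ) := by
      push_cast at h1 ⊢; linarith
    exact_mod_cast h4

/-- In the exponent q + 5, q cancels the growth of L^q, one power absorbs the constants, and four
remain. -/
theorem mul_rpow_mul_exp_neg_log_le {c C q L y : ℝ} (hc : 0 ≤ c) (hq : 0 ≤ q) (hL : 0 ≤ L)
    (hy : 1 ≤ y) (hLy : L ≤ C * y) (hcy : c * (6 * |C|) ^ q ≤ y) :
    c * (6 * L) ^ q * Real.exp (-((q + 5) * Real.log y)) ≤ 1 / y ^ 4 := by
  have hy0 : 0 < y := by linarith
  have hexp : Real.exp (-((q + 5) * Real.log y)) = 1 / (y ^ q * y ^ 5) := by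
    rw [Real.exp_neg, mul_comm, Real.exp_mul, Real.exp_log hy0, Real.rpow_add hy0, one_div]
    congr 2
    exact_mod_cast Real.rpow_natCast y 5
  have hLy' : 6 * L ≤ 6 * |C| * y := by
    have := mul_le_mul_of_nonneg_right (le_abs_self C) hy0.le
    linarith
  calc _ ≤ c * (6 * |C| * y) ^ q * (1 / (y ^ q * y ^ 5)) := by rw [hexp]; gcongr
    _ = c * (6 * |C|) ^ q * (1 / y ^ 5) := by
      rw [Real.mul_rpow (by positivity) hy0.le]
      have : y ^ q ≠ 0 := by positivity
      field_simp
    _ ≤ y * (1 / y ^ 5) := by gcongr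
    _ = 1 / y ^ 4 := by field_simp

theorem PotentialBound.gap_tail {d : ℝ} {hd : 1 < d} {a b : ℝ} (hab : PotentialBound hd a b) :
    ∃ γ α : ℝ, ∀ τ : ℕ → ℝ, Tendsto (fun n : ℕ => τ n / Real.log n) atTop atTop →
      ∃ N : ℕ, ∀ (n : ℕ) [NeZero n], N ≤ n → ∀ t : ℕ, τ n ≤ t → ∀ k : ℝ, 0 ≤ k →
        (allocationAt hd n t).real
            {x | Real.logb d (Real.log n) + α * Real.log (Real.log (Real.log n)) + k + γ ≤ gap x}
          ≤ 1 / (n : ℝ) ^ 10 + 1 / Real.log n ^ 4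
            + Real.exp (-a * k) / Real.log (Real.log n) ^ 4 := by
  have ha := hab.1
  obtain ⟨B, hB0, hB⟩ := hab.exists_iterate_le
  have hd1 : 0 < d - 1 := by linarith
  set q := 1 / (d - 1) with hq
  have hq0 : 0 < q := by positivity
  set γ : ℝ := ⌈24 / (d - 1)⌉₊ + 2 with hγ
  have hγ0 : 2 ≤ γ := by
    have : (0 : ℝ) ≤ (⌈24 / (d - 1)⌉₊ : ℝ) := Nat.cast_nonneg _
    linarith
  have hlogd : 0 < Real.log d := Real.log_pos hd
  set C₁ := 12 / a + 1 with hC₁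
  set C₂ := 1 / Real.log d + (q + 5) / a + γ + 1 with hC₂
  have hC₁0 : 0 < C₁ := by positivity
  have hC₂0 : 0 < C₂ := by positivity
  refine ⟨γ, (q + 5) / a, fun τ hτ => ?_⟩
  have hll := Real.tendsto_log_atTop.comp tendsto_log_natCast
  suffices h : ∀ᶠ n : ℕ in atTop, ∀ [NeZero n], ∀ t : ℕ, τ n ≤ t → ∀ k : ℝ, 0 ≤ k →
      (allocationAt hd n t).real
          {x | Real.logb d (Real.log n) + (q + 5) / a * Real.log (Real.log (Real.log n)) + k + γ
            ≤ gap x}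
        ≤ 1 / (n : ℝ) ^ 10 + 1 / Real.log n ^ 4
          + Real.exp (-a * k) / Real.log (Real.log n) ^ 4 by
    obtain ⟨N, hN⟩ := eventually_atTop.1 h
    exact ⟨N, fun n _ hn => hN n hn⟩
  filter_upwards [hB, eventually_gap_reduction hd ha hB (C₁ + C₂),
    hτ.eventually_ge_atTop (C₁ + C₂), hll.eventually_ge_atTop 1,
    hll.eventually_ge_atTop (B * Real.exp 1 * (6 * |C₂|) ^ q),
    tendsto_log_natCast.eventually_ge_atTop 1,
    tendsto_log_natCast.eventually_ge_atTop (B * Real.exp 1 * (6 * |C₁|) ^ q),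
    tendsto_natCast_atTop_atTop.eventually_ge_atTop (B + 2)]
    with n hB hred hτn hll1 hllB hlg1 hlgB hnB _ t ht k hk
  simp only [Function.comp] at hll1 hllB
  have hn : (0 : ℝ) < n := by exact_mod_cast Nat.pos_of_ne_zero (NeZero.ne n)
  set lg := Real.log n with hlg
  set ll := Real.log lg with hlldef
  have hlg0 : 0 < lg := by linarith
  have hll0 : 0 < ll := by linarith
  have hll_le : ll ≤ lg := (Real.log_le_sub_one_of_pos hlg0).trans (by linarith)
  have hlll : 0 ≤ Real.log ll := Real.log_nonneg hll1
  have hlogb : Real.logb d lg = 1 / Real.log d * ll := by rw [Real.logb]; ring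
  have hlogb0 : 0 ≤ Real.logb d lg := Real.logb_nonneg hd hlg1
  set g₁ := (q + 5) / a * ll with hg₁
  set g₂ := (q + 5) / a * Real.log ll + k with hg₂
  have hg₁0 : 0 ≤ g₁ := by positivity
  have hg₂0 : 0 ≤ g₂ := by positivity
  -- Then e^(a L₁) ≥ n^12, so the initial gap reaches L₁ with probability at most B / n^11.
  set L₁ := ⌈12 / a * lg⌉₊ with hL₁
  -- The gap bound left by the first phase, rounded up, is the starting bound of the second.
  set L₂ := ⌈Real.logb d lg + g₁ + γ⌉₊ with hL₂
  have hL₁1 : 1 ≤ L₁ := Nat.ceil_pos.2 (by positivity)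
  have hL₂1 : 1 ≤ L₂ := Nat.ceil_pos.2 (by linarith)
  have hL₁C : (L₁ : ℝ) ≤ C₁ * lg := by
    have := Nat.ceil_lt_add_one (by positivity : 0 ≤ 12 / a * lg)
    rw [hC₁, add_mul]; linarith
  have hL₂C : (L₂ : ℝ) ≤ C₂ * ll := by
    have := Nat.ceil_lt_add_one (by linarith : 0 ≤ Real.logb d lg + g₁ + γ)
    have h1 : γ ≤ γ * ll := le_mul_of_one_le_right (by linarith) hll1
    have h2 : C₂ * ll = Real.logb d lg + g₁ + γ * ll + ll := by rw [hlogb, hg₁, hC₂]; ring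
    linarith
  have hL₂C' : (L₂ : ℝ) ≤ C₂ * lg := hL₂C.trans (mul_le_mul_of_nonneg_left hll_le hC₂0.le)
  have hLt : L₁ + L₂ ≤ t := by
    have h1 : (C₁ + C₂) * lg ≤ τ n := (le_div_iff₀ hlg0).1 hτn
    have h2 : ((L₁ + L₂ : ℕ) : ℝ) ≤ t := by push_cast; linarith
    exact_mod_cast h2
  -- Both phases fit before time t because t ≥ τ n ≥ (C₁ + C₂) log n.
  obtain ⟨t₀, rfl⟩ := Nat.exists_eq_add_of_le' hLt
  have hstart := probFrom_gap_ge_le hd ha (hB t₀) L₁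
  have hstart' : B * n / Real.exp (a * L₁) ≤ B / (n : ℝ) ^ 11 := by
    have h1 : (n : ℝ) ^ 12 ≤ Real.exp (a * L₁) := by
      rw [← Real.exp_log hn, ← Real.exp_nat_mul, Real.exp_le_exp, ← hlg]
      have := mul_le_mul_of_nonneg_left (Nat.le_ceil (12 / a * lg)) ha.le
      rw [← mul_assoc, mul_div_cancel₀ _ ha.ne'] at this
      exact_mod_cast this
    calc _ ≤ B * n / (n : ℝ) ^ 12 := by gcongr
      _ = _ := by field_simp
  have h₁ := hred t₀ L₁ g₁ hL₁1 (by linarith [mul_nonneg hC₂0.le hlg0.le]) hg₁0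
  have h₂ := hred (t₀ + L₁) L₂ g₂ hL₂1 (by linarith [mul_nonneg hC₁0.le hlg0.le]) hg₂0
  have hmid : probFrom d ((t₀ + L₁) * n) (fun _ : Fin n => 0) {x | (L₂ : ℝ) ≤ gap x} ≤
      probFrom d ((t₀ + L₁) * n) (fun _ : Fin n => 0)
        {x | Real.logb d lg + g₁ + γ ≤ gap x} :=
    probFrom_mono_of_sum hd _ fun y _ hy =>
      show _ ≤ gap y from (Nat.le_ceil _).trans (show (L₂ : ℝ) ≤ gap y from hy)
  have he₁ : B * Real.exp 1 * (6 * L₁ : ℝ) ^ q * Real.exp (-(a * g₁)) ≤ 1 / lg ^ 4 := by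
    have : a * g₁ = (q + 5) * Real.log lg := by rw [hg₁, ← hlldef]; field_simp
    rw [this]
    exact mul_rpow_mul_exp_neg_log_le (by positivity) hq0.le (Nat.cast_nonneg _) hlg1 hL₁C hlgB
  have he₂ : B * Real.exp 1 * (6 * L₂ : ℝ) ^ q * Real.exp (-(a * g₂))
      ≤ Real.exp (-a * k) / ll ^ 4 := by
    have h1 : -(a * g₂) = -((q + 5) * Real.log ll) + -a * k := by rw [hg₂]; field_simp; ring
    rw [h1, Real.exp_add, ← mul_assoc, div_eq_mul_one_div, mul_comm (Real.exp (-a * k))]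
    exact mul_le_mul_of_nonneg_right (mul_rpow_mul_exp_neg_log_le (by positivity) hq0.le
      (Nat.cast_nonneg _) hll1 hL₂C hllB) (Real.exp_nonneg _)
  have hn11 : B / (n : ℝ) ^ 11 + 1 / (n : ℝ) ^ 11 + 1 / (n : ℝ) ^ 11 ≤ 1 / (n : ℝ) ^ 10 := by
    calc _ = (B + 2) / (n : ℝ) ^ 11 := by ring
      _ ≤ n / (n : ℝ) ^ 11 := by gcongr
      _ = _ := by field_simp
  rw [real_allocationAt, show t₀ + (L₁ + L₂) = t₀ + L₁ + L₂ by ring, add_assoc (Real.logb d lg)]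
  linarith

end Greedy

end

theorem mainTheorem3 (d : ℝ) (hd : 1 < d) :
    (∃ a b : ℝ, Greedy.PotentialBound hd a b) ∧
    ∀ a b : ℝ, Greedy.PotentialBound hd a b →
      ∃ γ α : ℝ, ∀ τ : ℕ → ℝ,
        Tendsto (fun n : ℕ => τ n / Real.log n) atTop atTop →
        ∃ N : ℕ, ∀ (n : ℕ) [NeZero n], N ≤ n →
          ∀ t : ℕ, τ n ≤ t → ∀ k : ℝ, 0 ≤ k →
            (Greedy.allocationAt hd n t).real
                {x | Real.logb d (Real.log n) + α * Real.log (Real.log (Real.log n)) + k + γ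
                      ≤ Greedy.gap x}
              ≤ 1 / (n : ℝ) ^ 10 + 1 / Real.log n ^ 4
                + Real.exp (-a * k) / Real.log (Real.log n) ^ 4 :=
  ⟨Greedy.exists_potentialBound hd, fun _ _ hab => hab.gap_tail⟩
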